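/- Let $F$ be a finite field, $x_1,\dots,x_N\in F$ distinct, $2\le K\le N$, and let $\mathcal C_{\mathrm{RS}}=\{(f(x_1),\dots,f(x_N)) : f\in F[x],\ \deg f<K\}$ be the corresponding Reed–Solomon code of length $N$ and dimension $K$. For a multiset $C$ of words in $F^N$ let $\mathrm{hist}(C)$ be the $F\times[N]$ matrix whose $(a,j)$ entry is the number (with multiplicity) of $c\in C$ with $c_j=a$. For $c\in F^N$ let $W_c\in\{0,1\}^{F\times[N]}$ be its one-hot (Kautz–Singleton) matrix, with $(a,j)$ entry $1$ iff $c_j=a$, and let $\langle W,M\rangle=\sum_{a,j}W_{a,j}M_{a,j}$. **Kautz–Singleton list decoding** of a nonnegative integer matrix $M$: choose a nonzero $Q(x,y)\in F[x,y]$ of least $(1,K-1)$-weighted degree among those that pass through each point $(x_j,a)$ with multiplicity at least $M_{a,j}$; output all codewords $(f(x_1),\dots,f(x_N))$ with $\deg f<K$ and $y-f(x)\mid Q(x,y)$. **Algorithm.** The input is an integer matrix $H'\in\mathbb Z^{F\times[N]}$, a positive integer $d$, and a nonnegative integer $s$ (the assumed bound on the number of wrong columns). Put $R=H'$ and repeat: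 1. Take the majority value $\tau$ of the column sums of $R$, and let $P$ be $R$ with each column set to zero whose sum is not $\tau$ or which has a negative entry. 2. If $P=0$, stop. 3. Otherwise let $Y'\in\{0,1\}^{F\times[N]}$ have entry $1$ exactly where $P$ is positive, apply Kautz–Singleton list decoding to $M'=dY'$, and reject every codeword $c$ in the list with $\langle W_c,M'\rangle<d(N-s)$. 4. Record each remaining codeword once, subtract the histograms $\mathrm{hist}$ of the set of remaining codewords from $R$, and continue with the new $R$. The output is the multiset of all recorded codewords. **Theorem.** Let $C$ be a multiset of $t$ codewords of $\mathcal C_{\mathrm{RS}}$, of which $u$ are distinct, and let $H=\mathrm{hist}(C)$. Let $r,s\ge 0$ be integers with $(r+1)s<N$, and let $H'\in\mathbb Z^{F\times[N]}$ differ from $H$ in at most $s$ columns, and in each column by at most $r$ in $\ell_1$-distance. Let $d$ be a positive integer. If $$u\le\min\left\{\left\lfloor\frac{d(N-s)^2}{N(d+1)(K-1)}\right\rfloor,\ \left\lfloor\frac{N-s-rs-1}{K-1}\right\rfloor\right\},$$ then, whichever admissible polynomials $Q$ are chosen in the list-decoding steps, the algorithm with input $H'$, $d$, $s$ terminates and returns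 exactly $C$, i.e. the $t$ codewords with their correct multiplicities. -/

import Mathlib

namespace HistogramRecovery

section Codes

variable {F : Type*} [Field F] {N : ℕ}

/-- The word `(f(x₁), …, f(x_N))` of values of a polynomial at the evaluation points. -/
def evalWord (x : Fin N ↪ F) (f : Polynomial F) : Fin N → F := fun j => f.eval (x j)

/-- The Reed–Solomon code with the distinct evaluation points `x₁, …, x_N`: all words of values of
polynomials of degree less than `K`. It has length `N`, and dimension `K` when `K ≤ N`. -/
def reedSolomon (x : Fin N ↪ F) (K : ℕ) : Set (Fin N → F) :=
  {c | ∃ f : Polynomial F, f.degree < (K : WithBot ℕ) ∧ c = evalWord x f}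

/-- The Kautz–Singleton (one-hot) matrix of a word: rows are indexed by the field elements, columns
by the positions, and the entry `(a, j)` is `1` exactly when the `j`-th symbol is `a`. -/
def kautzSingleton [DecidableEq F] (c : Fin N → F) : Matrix F (Fin N) ℕ :=
  fun a j => if c j = a then 1 else 0

/-- The inner product of two matrices, i.e. the sum of the products of corresponding entries. -/
def innerProduct [Fintype F] (W M : Matrix F (Fin N) ℕ) : ℕ := ∑ a, ∑ j, W a j * M a j

/-- The histograms of a multiset of words: the entry `(a, j)` counts, with multiplicity, the words
whose `j`-th symbol is `a`. The `j`-th column is the `j`-th histogram. -/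
def histogram [DecidableEq F] (C : Multiset (Fin N → F)) : Matrix F (Fin N) ℤ :=
  fun a j => (C.countP (fun c => c j = a) : ℤ)

/-- The `ℓ₁`-distance of the `j`-th columns. -/
def colDist [Fintype F] (H H' : Matrix F (Fin N) ℤ) (j : Fin N) : ℕ :=
  ∑ a, (H a j - H' a j).natAbs

/-- The number of columns in which the two matrices differ. -/
def e₁ [Fintype F] [DecidableEq F] (H H' : Matrix F (Fin N) ℤ) : ℕ :=
  (Finset.univ.filter fun j : Fin N => (fun a => H a j) ≠ (fun a => H' a j)).card

/-- The largest `ℓ₁`-distance between corresponding columns. -/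
def e₂ [Fintype F] (H H' : Matrix F (Fin N) ℤ) : ℕ :=
  Finset.univ.sup fun j : Fin N => colDist H H' j

end Codes

section ListDecoding

variable {F : Type*} [Field F] {N : ℕ}

/-! A bivariate polynomial `Q(x, y)` is a polynomial in `y` with coefficients in `F[x]`:
the coefficient of `x ^ i * y ^ k` is `(Q.coeff k).coeff i`. -/

/-- The translate `Q(x + a, y + b)`. -/
noncomputable def shiftPoly (a b : F) (Q : Polynomial (Polynomial F)) :
    Polynomial (Polynomial F) :=
  (Q.map (Polynomial.compRingHom (Polynomial.X + Polynomial.C a))).comp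
    (Polynomial.X + Polynomial.C (Polynomial.C b))

/-- `Q` passes through the point `(a, b)` with multiplicity at least `m`: the translate
`Q(x + a, y + b)` has no monomial of total degree less than `m`. -/
def HasMultiplicity (m : ℕ) (a b : F) (Q : Polynomial (Polynomial F)) : Prop :=
  ∀ i k : ℕ, i + k < m → ((shiftPoly a b Q).coeff k).coeff i = 0

/-- The `(1, v)`-weighted degree of `Q`: the largest `i + v * k` over its monomials
`x ^ i * y ^ k`. -/
noncomputable def weightedDegree (v : ℕ) (Q : Polynomial (Polynomial F)) : ℕ :=
  Q.support.sup fun k => (Q.coeff k).natDegree + v * k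

/-- `Q` is nonzero and passes through every point `(x_j, a)` with multiplicity at least `M a j`. -/
def Interpolates (x : Fin N ↪ F) (M : Matrix F (Fin N) ℕ) (Q : Polynomial (Polynomial F)) : Prop :=
  Q ≠ 0 ∧ ∀ a j, HasMultiplicity (M a j) (x j) a Q

/-- A possible result of the interpolation step with multiplicity matrix `M`: an interpolating
polynomial of least `(1, K - 1)`-weighted degree. -/
def IsInterpolant (x : Fin N ↪ F) (K : ℕ) (M : Matrix F (Fin N) ℕ)
    (Q : Polynomial (Polynomial F)) : Prop :=
  Interpolates x M Q ∧
    ∀ Q' : Polynomial (Polynomial F), Interpolates x M Q' →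
      weightedDegree (K - 1) Q ≤ weightedDegree (K - 1) Q'

/-- The result of the factorization step: the codewords that come from the factors `y - f(x)` of
`Q` with `f` of degree less than `K`. -/
def factorWords (x : Fin N ↪ F) (K : ℕ) (Q : Polynomial (Polynomial F)) : Set (Fin N → F) :=
  {c | ∃ f : Polynomial F, f.degree < (K : WithBot ℕ) ∧
    (Polynomial.X - Polynomial.C f) ∣ Q ∧ c = evalWord x f}

/-- `L` is a possible output of Kautz–Singleton list decoding on input `M`: interpolation with
multiplicities `M`, followed by factorization. -/
def IsListDecoding (x : Fin N ↪ F) (K : ℕ) (M : Matrix F (Fin N) ℕ) (L : Set (Fin N → F)) : Prop :=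
  ∃ Q : Polynomial (Polynomial F), IsInterpolant x K M Q ∧ L = factorWords x K Q

end ListDecoding

section Algorithm

variable {F : Type*} [Field F] [Fintype F] [DecidableEq F] {N : ℕ}

/-- `τ` is the sum of the entries of more than half of the columns. -/
def IsMajoritySum (R : Matrix F (Fin N) ℤ) (τ : ℤ) : Prop :=
  N < 2 * (Finset.univ.filter fun j : Fin N => ∑ a, R a j = τ).card

/-- `P` is the outcome of preprocessing `R`: a majority vote over the column sums is taken, and
every column whose sum loses the vote or which has a negative entry is set to zero. -/
def IsPreprocessing (R P : Matrix F (Fin N) ℤ) : Prop :=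
  ∃ τ : ℤ, IsMajoritySum R τ ∧
    ∀ a j, P a j = if (∑ b, R b j = τ) ∧ (∀ b, 0 ≤ R b j) then R a j else 0

/-- The `0/1`-matrix that marks the positive entries. -/
def positivePattern (P : Matrix F (Fin N) ℤ) : Matrix F (Fin N) ℕ :=
  fun a j => if 0 < P a j then 1 else 0

/-- A configuration of the algorithm: the current residual histograms and the multiset of
codewords found so far. -/
structure Config (F : Type*) (N : ℕ) where
  residual : Matrix F (Fin N) ℤ
  found : Multiset (Fin N → F)

/-- The algorithm stops when the preprocessed residual histograms are zero. -/
def Halted (σ : Config F N) : Prop := IsPreprocessing σ.residual 0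

/-- One iteration. The residual is preprocessed to `P`, which is not zero; list decoding of the
matrix `d • Y`, with `Y` marking the positive entries of `P`, gives `L`; the codewords of `L` whose
Kautz–Singleton matrix has inner product less than `d * (N - s)` with `d • Y` are rejected; each
remaining codeword (the set `S`) is recorded once and the histograms of `S` are subtracted. -/
def Step (x : Fin N ↪ F) (K d s : ℕ) (σ σ' : Config F N) : Prop :=
  ∃ (P : Matrix F (Fin N) ℤ) (L : Set (Fin N → F)) (S : Finset (Fin N → F)),
    IsPreprocessing σ.residual P ∧ P ≠ 0 ∧
    IsListDecoding x K (d • positivePattern P) L ∧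
    (∀ c, c ∈ S ↔
      c ∈ L ∧ d * (N - s) ≤ innerProduct (kautzSingleton c) (d • positivePattern P)) ∧
    σ'.residual = σ.residual - histogram S.val ∧
    σ'.found = σ.found + S.val

/-- The algorithm with parameters `d` and `s`, started on the histograms `H'`, returns `out`:
whatever interpolants are chosen, the run is finite, and the configuration in which it cannot be
continued is a halted one in which exactly `out` has been found. -/
def Returns (x : Fin N ↪ F) (K d s : ℕ) (H' : Matrix F (Fin N) ℤ)
    (out : Multiset (Fin N → F)) : Prop :=
  Acc (fun σ' σ => Step x K d s σ σ') ⟨H', 0⟩ ∧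
    ∀ σ : Config F N, Relation.ReflTransGen (Step x K d s) ⟨H', 0⟩ σ →
      (¬ ∃ σ', Step x K d s σ σ') → Halted σ ∧ σ.found = out

end Algorithm

end HistogramRecovery

/-!
Let `B` be the set of columns in which `H` and `H'` differ. The hypotheses give
`u * (K - 1) + |B| + s < N` with `|B| ≤ s` (when `r = 0` no column is wrong). At every stage the
codewords found form a sub-multiset of `C`, and outside `B` the residual is the histogram matrix of
the multiset `D` of codewords still missing. Three facts then drive the algorithm.

* More than half of the columns lie outside `B`, so the majority vote returns `|D|`, and the
  preprocessed matrix vanishes exactly when `D = 0` (`preprocessing_eq_zero_iff`).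
* Every word of `D` is listed. The polynomial
  `∏_{f ∈ D} (y - f(x)) ^ d * ∏_{j ∈ B} (x - x_j) ^ d` passes through all the marked points with
  multiplicity `d`, and its weighted degree is at most `d * (u * (K - 1) + |B|) < d * (N - s)`
  (`exists_interpolates`). Hence the least weighted degree is below `d * (N - s)`, which the score
  of each word of `D` attains, so that `Q(x, f(x))` has more zeros than its degree allows and
  `y - f(x)` divides `Q` (`dvd_of_weightedDegree_lt_innerProduct`).
* Nothing else survives the rejection: a codeword outside `D` agrees with each of the at most `u`
  distinct words of `D` in at most `K - 1` positions, so it meets fewer than `N - s` marked points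
  (`mem_of_le_innerProduct`).

So each iteration removes every distinct missing codeword exactly once, the number of missing
codewords drops, and the run stops exactly when none is missing.
-/

namespace HistogramRecovery

/-! ### Multiplicities of bivariate polynomials -/

section Multiplicity

open Polynomial

variable {F : Type*} [Field F]

lemma shiftPoly_mul (a b : F) (P Q : F[X][X]) :
    shiftPoly a b (P * Q) = shiftPoly a b P * shiftPoly a b Q := by
  simp [shiftPoly, Polynomial.map_mul, mul_comp]

lemma HasMultiplicity.mul {m n : ℕ} {a b : F} {P Q : F[X][X]}
    (hP : HasMultiplicity m a b P) (hQ : HasMultiplicity n a b Q) :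
    HasMultiplicity (m + n) a b (P * Q) := by
  intro i k hik
  rw [shiftPoly_mul, coeff_mul, finsetSum_coeff]
  refine Finset.sum_eq_zero fun p hp => ?_
  rw [coeff_mul]
  refine Finset.sum_eq_zero fun q hq => ?_
  rw [Finset.HasAntidiagonal.mem_antidiagonal] at hp hq
  by_cases h : q.1 + p.1 < m
  · rw [hP _ _ h, zero_mul]
  · rw [hQ q.2 p.2 (by omega), mul_zero]

lemma HasMultiplicity.zero (a b : F) (Q : F[X][X]) : HasMultiplicity 0 a b Q :=
  fun _ _ h => absurd h (Nat.not_lt_zero _)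

lemma HasMultiplicity.of_dvd {m : ℕ} {a b : F} {P Q : F[X][X]}
    (hP : HasMultiplicity m a b P) (h : P ∣ Q) : HasMultiplicity m a b Q := by
  obtain ⟨T, rfl⟩ := h
  exact hP.mul (HasMultiplicity.zero a b T)

lemma HasMultiplicity.pow {a b : F} {P : F[X][X]} (hP : HasMultiplicity 1 a b P) (n : ℕ) :
    HasMultiplicity n a b (P ^ n) := by
  induction n with
  | zero => exact HasMultiplicity.zero _ _ _
  | succ n ih => rw [pow_succ]; exact ih.mul hP

lemma hasMultiplicity_X_sub_C {a b : F} {f : F[X]} (h : f.eval a = b) :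
    HasMultiplicity 1 a b (X - C f) := by
  intro i k hik
  obtain rfl : i = 0 := by omega
  obtain rfl : k = 0 := by omega
  simp [shiftPoly, coeff_zero_eq_eval_zero, h]

lemma hasMultiplicity_C_X_sub_C (a b : F) :
    HasMultiplicity 1 a b (C (X - C a) : F[X][X]) := by
  intro i k hik
  obtain rfl : i = 0 := by omega
  obtain rfl : k = 0 := by omega
  simp [shiftPoly]

/-- Substituting `y = f(x)` turns a point of multiplicity `m` on the graph of `f` into a zero of
order `m`. -/
lemma HasMultiplicity.pow_dvd_eval {m : ℕ} {a : F} {f : F[X]} {Q : F[X][X]}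
    (hQ : HasMultiplicity m a (f.eval a) Q) : (X - C a) ^ m ∣ Q.eval f := by
  set g : F[X] := f.comp (X + C a) - C (f.eval a) with hg
  have hXg : X ∣ g := by
    rw [X_dvd_iff, coeff_zero_eq_eval_zero]; simp [hg]
  have hcomp : (Q.eval f).comp (X + C a) = (shiftPoly a (f.eval a) Q).eval g := by
    have h1 : g + C (f.eval a) = compRingHom (X + C a) f := by simp [hg]
    rw [shiftPoly, eval_comp, eval_add, eval_X, eval_C, h1, eval_map_apply]
    rfl
  have hdvd : X ^ m ∣ (Q.eval f).comp (X + C a) := by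
    rw [hcomp, eval_eq_sum, sum_def]
    refine Finset.dvd_sum fun k _ => ?_
    have hk : X ^ (m - k) ∣ (shiftPoly a (f.eval a) Q).coeff k := by
      rw [X_pow_dvd_iff]
      intro i hi
      exact hQ i k (by omega)
    exact (pow_dvd_pow X (by omega : m ≤ (m - k) + k)).trans
      (by rw [pow_add]; exact mul_dvd_mul hk (pow_dvd_pow_of_dvd hXg k))
  obtain ⟨q, hq⟩ := hdvd
  refine ⟨q.comp (X - C a), ?_⟩
  have h2 := congrArg (fun p : F[X] => p.comp (X - C a)) hq
  simpa [comp_assoc, mul_comp] using h2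

end Multiplicity

/-! ### Weighted degrees -/

section WeightedDegree

open Polynomial

variable {F : Type*} [Field F]

lemma weightedDegree_le_iff {v n : ℕ} {Q : F[X][X]} :
    weightedDegree v Q ≤ n ↔ ∀ i k, (Q.coeff k).coeff i ≠ 0 → i + v * k ≤ n := by
  rw [weightedDegree, Finset.sup_le_iff]
  constructor
  · intro h i k hik
    have hk : Q.coeff k ≠ 0 := fun h0 => hik (by rw [h0, coeff_zero])
    exact (Nat.add_le_add_right (le_natDegree_of_ne_zero hik) _).trans
      (h k (mem_support_iff.2 hk))
  · intro h k hk
    refine h _ _ ?_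
    rw [coeff_natDegree]
    exact leadingCoeff_ne_zero.2 (mem_support_iff.1 hk)

lemma weightedDegree_mul_le (v : ℕ) (P Q : F[X][X]) :
    weightedDegree v (P * Q) ≤ weightedDegree v P + weightedDegree v Q := by
  rw [weightedDegree_le_iff]
  intro i k hik
  rw [coeff_mul, finsetSum_coeff] at hik
  obtain ⟨p, hp, hp'⟩ := Finset.exists_ne_zero_of_sum_ne_zero hik
  rw [coeff_mul] at hp'
  obtain ⟨q, hq, hq'⟩ := Finset.exists_ne_zero_of_sum_ne_zero hp'
  have h1 := (weightedDegree_le_iff (v := v)).1 le_rfl _ _ (left_ne_zero_of_mul hq')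
  have h2 := (weightedDegree_le_iff (v := v)).1 le_rfl _ _ (right_ne_zero_of_mul hq')
  rw [Finset.HasAntidiagonal.mem_antidiagonal] at hp hq
  rw [← hp, ← hq, mul_add]
  omega

lemma weightedDegree_one (v : ℕ) : weightedDegree v (1 : F[X][X]) = 0 := by
  rw [← Nat.le_zero, weightedDegree_le_iff]
  intro i k h
  rw [coeff_one] at h
  split_ifs at h with hk
  · rw [coeff_one] at h
    split_ifs at h with hi
    · simp [hi, hk]
    · exact absurd rfl h
  · simp at h

lemma weightedDegree_pow_le (v : ℕ) (P : F[X][X]) (n : ℕ) :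
    weightedDegree v (P ^ n) ≤ n * weightedDegree v P := by
  induction n with
  | zero => simp [weightedDegree_one]
  | succ n ih =>
    rw [pow_succ, Nat.succ_mul]
    exact (weightedDegree_mul_le v _ _).trans (Nat.add_le_add_right ih _)

lemma weightedDegree_prod_le {ι : Type*} (v : ℕ) (S : Finset ι) (P : ι → F[X][X]) :
    weightedDegree v (∏ i ∈ S, P i) ≤ ∑ i ∈ S, weightedDegree v (P i) := by
  classical
  induction S using Finset.induction_on with
  | empty => simp [weightedDegree_one]
  | insert a S ha ih =>
    rw [Finset.prod_insert ha, Finset.sum_insert ha]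
    exact (weightedDegree_mul_le v _ _).trans (Nat.add_le_add_left ih _)

lemma weightedDegree_X_sub_C_le {v : ℕ} {f : F[X]} (hf : f.natDegree ≤ v) :
    weightedDegree v (X - C f) ≤ v := by
  rw [weightedDegree, Finset.sup_le_iff]
  intro k hk
  rw [mem_support_iff] at hk
  rcases k with _ | _ | k
  · simpa using hf
  · simp [coeff_X]
  · simp [coeff_X] at hk

lemma weightedDegree_C_X_sub_C_le (v : ℕ) (a : F) :
    weightedDegree v (C (X - C a) : F[X][X]) ≤ 1 := by
  rw [weightedDegree, Finset.sup_le_iff]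
  intro k hk
  rw [mem_support_iff] at hk
  rcases k with _ | k
  · simp
  · simp at hk

lemma natDegree_eval_le_weightedDegree {v : ℕ} {f : F[X]} (hf : f.natDegree ≤ v) (Q : F[X][X]) :
    (Q.eval f).natDegree ≤ weightedDegree v Q := by
  rw [eval_eq_sum, sum_def]
  refine natDegree_sum_le_of_forall_le _ _ fun k hk => ?_
  refine natDegree_mul_le.trans (le_trans ?_
    (Finset.le_sup (f := fun k => (Q.coeff k).natDegree + v * k) hk))
  refine Nat.add_le_add_left (natDegree_pow_le.trans ?_) _
  rw [mul_comm]
  exact Nat.mul_le_mul_right _ hf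

end WeightedDegree

/-! ### Interpolation and list decoding -/

section Score

variable {F : Type*} [Fintype F] [DecidableEq F] {N : ℕ}

lemma innerProduct_kautzSingleton (c : Fin N → F)
    (M : Matrix F (Fin N) ℕ) : innerProduct (kautzSingleton c) M = ∑ j, M (c j) j := by
  rw [innerProduct, Finset.sum_comm]
  simp [kautzSingleton]

end Score

section ListDecoding

open Polynomial

variable {F : Type*} [Field F] {N : ℕ}

/-- A polynomial `f` whose word scores more than the weighted degree of an interpolating `Q` gives
a factor `y - f(x)` of `Q`. -/
lemma dvd_of_weightedDegree_lt_innerProduct [Fintype F] [DecidableEq F] {x : Fin N ↪ F} {v : ℕ}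
    {M : Matrix F (Fin N) ℕ} {Q : F[X][X]} (hQ : Interpolates x M Q) {f : F[X]}
    (hf : f.natDegree ≤ v)
    (hlt : weightedDegree v Q < innerProduct (kautzSingleton (evalWord x f)) M) :
    (X - C f) ∣ Q := by
  rw [dvd_iff_isRoot, IsRoot.def]
  by_contra h0
  have hdvd : ∏ j, (X - C (x j)) ^ M (evalWord x f j) j ∣ Q.eval f := by
    refine Finset.prod_dvd_of_coprime (fun i _ j _ hij => ?_) fun j _ => ?_
    · exact (pairwise_coprime_X_sub_C x.injective hij).pow
    · exact HasMultiplicity.pow_dvd_eval (hQ.2 _ j)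
  have h1 := natDegree_le_of_dvd hdvd h0
  rw [natDegree_prod _ _ fun j _ => pow_ne_zero _ (X_sub_C_ne_zero _)] at h1
  simp only [natDegree_pow, natDegree_X_sub_C, mul_one] at h1
  rw [innerProduct_kautzSingleton] at hlt
  exact absurd (h1.trans (natDegree_eval_le_weightedDegree hf Q)) (not_le.2 hlt)

/-- If outside the columns `B` every point of positive multiplicity lies on the word of some
`f ∈ G`, then `∏ (y - f(x)) ^ d * ∏ (x - x_j) ^ d` interpolates. -/
lemma exists_interpolates {x : Fin N ↪ F} {v d : ℕ} {M : Matrix F (Fin N) ℕ}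
    (hM : ∀ a j, M a j ≤ d) {G : Finset F[X]} (hG : ∀ f ∈ G, f.natDegree ≤ v) {B : Finset (Fin N)}
    (hcover : ∀ j ∉ B, ∀ a, M a j ≠ 0 → ∃ f ∈ G, f.eval (x j) = a) :
    ∃ Q, Interpolates x M Q ∧ weightedDegree v Q ≤ d * (G.card * v + B.card) := by
  have mono : ∀ {m n : ℕ} {a b : F} {Q : F[X][X]}, m ≤ n → HasMultiplicity n a b Q →
      HasMultiplicity m a b Q := fun hmn h i k hik => h i k (hik.trans_le hmn)
  refine ⟨(∏ f ∈ G, (X - C f) ^ d) * ∏ j ∈ B, (C (X - C (x j))) ^ d, ⟨?_, fun a j => ?_⟩, ?_⟩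
  · refine mul_ne_zero (Finset.prod_ne_zero_iff.2 fun f _ => pow_ne_zero _ (X_sub_C_ne_zero _))
      (Finset.prod_ne_zero_iff.2 fun j _ => pow_ne_zero _ ?_)
    exact C_ne_zero.2 (X_sub_C_ne_zero _)
  · by_cases hj : j ∈ B
    · exact mono (hM a j) (((hasMultiplicity_C_X_sub_C (x j) a).pow d).of_dvd
        ((Finset.dvd_prod_of_mem _ hj).mul_left _))
    by_cases h0 : M a j = 0
    · rw [h0]; exact HasMultiplicity.zero _ _ _
    · obtain ⟨f, hf, hfa⟩ := hcover j hj a h0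
      exact mono (hM a j) (((hasMultiplicity_X_sub_C hfa).pow d).of_dvd
        ((Finset.dvd_prod_of_mem (fun f : F[X] => (X - C f) ^ d) hf).mul_right _))
  · refine (weightedDegree_mul_le _ _ _).trans ?_
    rw [mul_add]
    refine Nat.add_le_add ((weightedDegree_prod_le _ _ _).trans ?_)
      ((weightedDegree_prod_le _ _ _).trans ?_)
    · refine (Finset.sum_le_card_nsmul _ _ (d * v) fun f hf => ?_).trans (le_of_eq ?_)
      · exact (weightedDegree_pow_le _ _ _).trans
          (Nat.mul_le_mul_left _ (weightedDegree_X_sub_C_le (hG f hf)))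
      · rw [smul_eq_mul]; ring
    · refine (Finset.sum_le_card_nsmul _ _ (d * 1) fun j _ => ?_).trans (le_of_eq ?_)
      · exact (weightedDegree_pow_le _ _ _).trans
          (Nat.mul_le_mul_left _ (weightedDegree_C_X_sub_C_le v (x j)))
      · rw [smul_eq_mul]; ring

lemma exists_isInterpolant {x : Fin N ↪ F} {K : ℕ} {M : Matrix F (Fin N) ℕ}
    (h : ∃ Q, Interpolates x M Q) : ∃ Q, IsInterpolant x K M Q := by
  obtain ⟨Q, hQ, hmin⟩ :=
    WellFounded.has_min (measure (weightedDegree (F := F) (K - 1))).wf {Q | Interpolates x M Q} h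
  exact ⟨Q, hQ, fun Q' hQ' => not_lt.1 (hmin Q' hQ')⟩

/-- Two distinct codewords agree in at most `K - 1` positions. -/
lemma card_agreement_le [DecidableEq F] {x : Fin N ↪ F} {K : ℕ} {c c' : Fin N → F}
    (hc : c ∈ reedSolomon x K) (hc' : c' ∈ reedSolomon x K) (hne : c ≠ c') :
    (Finset.univ.filter fun j => c j = c' j).card ≤ K - 1 := by
  obtain ⟨f, hf, rfl⟩ := hc
  obtain ⟨g, hg, rfl⟩ := hc'
  by_contra! hlt
  have hK : (K : WithBot ℕ) ≤ (Finset.univ.filter fun j => evalWord x f j = evalWord x g j).card :=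
    by exact_mod_cast (by omega)
  refine hne (congrArg (evalWord x) ?_)
  exact eq_of_degrees_lt_of_eval_index_eq _ x.injective.injOn (hf.trans_le hK) (hg.trans_le hK)
    fun j hj => (Finset.mem_filter.1 hj).2

end ListDecoding

/-! ### Histograms and preprocessing -/

section Histograms

variable {F : Type*} [DecidableEq F] {N : ℕ}

lemma histogram_add (C D : Multiset (Fin N → F)) :
    histogram (C + D) = histogram C + histogram D := by
  ext a j
  simp [histogram]

lemma histogram_pos_iff {C : Multiset (Fin N → F)} {a : F} {j : Fin N} :
    0 < histogram C a j ↔ ∃ c ∈ C, c j = a := by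
  simp [histogram, Multiset.countP_pos]

lemma sum_histogram [Fintype F] (C : Multiset (Fin N → F)) (j : Fin N) : ∑ a, histogram C a j = C.card := by
  induction C using Multiset.induction_on with
  | empty => simp [histogram]
  | cons c C ih =>
    simp only [histogram] at ih
    simp [histogram, Multiset.countP_cons, Finset.sum_add_distrib, ih]

/-- Outside a minority `B` of the columns, `R` is the histogram matrix of `D`. -/
structure IsNoisyHistogram (B : Finset (Fin N)) (D : Multiset (Fin N → F))
    (R : Matrix F (Fin N) ℤ) : Prop where
  two_mul_card_lt : 2 * B.card < N
  eq_histogram : ∀ j ∉ B, ∀ a, R a j = histogram D a j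

variable [Fintype F] {B : Finset (Fin N)} {D : Multiset (Fin N → F)} {R P : Matrix F (Fin N) ℤ}

lemma IsNoisyHistogram.sum_eq (h : IsNoisyHistogram B D R) {j : Fin N} (hj : j ∉ B) :
    ∑ a, R a j = D.card := by
  rw [← sum_histogram D j]
  exact Finset.sum_congr rfl fun a _ => h.eq_histogram j hj a

lemma IsNoisyHistogram.isMajoritySum_iff (h : IsNoisyHistogram B D R) {τ : ℤ} :
    IsMajoritySum R τ ↔ τ = D.card := by
  have hcard : B.card + Bᶜ.card = N := by simp
  have hB := h.two_mul_card_lt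
  constructor
  · intro hτ
    by_contra hne
    have hsub : (Finset.univ.filter fun j : Fin N => ∑ a, R a j = τ) ⊆ B := by
      intro j hj
      by_contra hjB
      exact hne ((Finset.mem_filter.1 hj).2.symm.trans (h.sum_eq hjB))
    have := Finset.card_le_card hsub
    unfold IsMajoritySum at hτ
    omega
  · rintro rfl
    have hsub : Bᶜ ⊆ Finset.univ.filter fun j : Fin N => ∑ a, R a j = D.card := by
      intro j hj
      exact Finset.mem_filter.2 ⟨Finset.mem_univ _, h.sum_eq (Finset.mem_compl.1 hj)⟩
    have := Finset.card_le_card hsub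
    unfold IsMajoritySum
    omega

lemma IsNoisyHistogram.exists_preprocessing (h : IsNoisyHistogram B D R) :
    ∃ P, IsPreprocessing R P :=
  ⟨_, D.card, h.isMajoritySum_iff.2 rfl, fun _ _ => rfl⟩

lemma IsNoisyHistogram.preprocessing_eq (h : IsNoisyHistogram B D R) (hP : IsPreprocessing R P)
    {j : Fin N} (hj : j ∉ B) (a : F) : P a j = histogram D a j := by
  obtain ⟨τ, hτ, hP⟩ := hP
  obtain rfl := h.isMajoritySum_iff.1 hτ
  rw [hP, if_pos, h.eq_histogram j hj]
  refine ⟨h.sum_eq hj, fun b => ?_⟩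
  rw [h.eq_histogram j hj]
  exact Int.natCast_nonneg _

lemma IsNoisyHistogram.preprocessing_eq_zero_iff (h : IsNoisyHistogram B D R)
    (hP : IsPreprocessing R P) : P = 0 ↔ D = 0 := by
  constructor
  · rintro rfl
    have hlt : B.card < (Finset.univ : Finset (Fin N)).card := by
      have := h.two_mul_card_lt
      rw [Finset.card_univ, Fintype.card_fin]
      omega
    obtain ⟨j, -, hj⟩ := Finset.exists_mem_notMem_of_card_lt_card hlt
    have hs := sum_histogram D j
    rw [Finset.sum_eq_zero fun a _ => (h.preprocessing_eq hP hj a).symm] at hs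
    exact Multiset.card_eq_zero.1 (by exact_mod_cast hs.symm)
  · rintro rfl
    obtain ⟨τ, hτ, hP⟩ := hP
    obtain rfl := h.isMajoritySum_iff.1 hτ
    ext a j
    rw [hP, Matrix.zero_apply]
    split_ifs with hc
    -- nonnegative entries with sum `0` vanish
    · exact (Finset.sum_eq_zero_iff_of_nonneg fun b _ => hc.2 b).1 (by simpa using hc.1) a
        (Finset.mem_univ _)
    · rfl

lemma innerProduct_smul_positivePattern (c : Fin N → F) (d : ℕ) (P : Matrix F (Fin N) ℤ) :
    innerProduct (kautzSingleton c) (d • positivePattern P) =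
      d * (Finset.univ.filter fun j => 0 < P (c j) j).card := by
  rw [innerProduct_kautzSingleton]
  simp [positivePattern, Finset.sum_ite, mul_comm]

/-- A missing codeword meets the marked points in all correct columns, hence is not rejected. -/
lemma IsNoisyHistogram.le_innerProduct (h : IsNoisyHistogram B D R) (hP : IsPreprocessing R P)
    {s : ℕ} (hBs : B.card ≤ s) (d : ℕ) {c : Fin N → F} (hc : c ∈ D) :
    d * (N - s) ≤ innerProduct (kautzSingleton c) (d • positivePattern P) := by
  rw [innerProduct_smul_positivePattern]
  refine Nat.mul_le_mul_left _ ?_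
  have hsub : Bᶜ ⊆ Finset.univ.filter fun j => 0 < P (c j) j := by
    intro j hj
    refine Finset.mem_filter.2 ⟨Finset.mem_univ _, ?_⟩
    rw [h.preprocessing_eq hP (Finset.mem_compl.1 hj), histogram_pos_iff]
    exact ⟨c, hc, rfl⟩
  have h1 := Finset.card_le_card hsub
  have h2 : B.card + Bᶜ.card = N := by simp
  omega

end Histograms

/-! ### One iteration -/

section Iteration

variable {F : Type*} [Field F] [Fintype F] [DecidableEq F] {N K d s : ℕ} {x : Fin N ↪ F}
  {B : Finset (Fin N)} {D : Multiset (Fin N → F)} {R P : Matrix F (Fin N) ℤ}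

/-- A surviving codeword that was not missing would agree too often with some missing one: its
marked positions lie in `B` or among its agreements with the distinct words of `D`. -/
lemma IsNoisyHistogram.mem_of_le_innerProduct (h : IsNoisyHistogram B D R)
    (hP : IsPreprocessing R P) (hd : 0 < d) (hD : ∀ c ∈ D, c ∈ reedSolomon x K)
    (hlt : D.toFinset.card * (K - 1) + B.card + s < N) {c : Fin N → F} (hc : c ∈ reedSolomon x K)
    (hle : d * (N - s) ≤ innerProduct (kautzSingleton c) (d • positivePattern P)) : c ∈ D := by
  rw [innerProduct_smul_positivePattern] at hle
  replace hle := Nat.le_of_mul_le_mul_left hle hd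
  by_contra hcD
  have hsub : (Finset.univ.filter fun j => 0 < P (c j) j) ⊆
      B ∪ D.toFinset.biUnion fun c' => Finset.univ.filter fun j => c j = c' j := by
    intro j hj
    by_cases hjB : j ∈ B
    · exact Finset.mem_union_left _ hjB
    have hpos := (Finset.mem_filter.1 hj).2
    rw [h.preprocessing_eq hP hjB, histogram_pos_iff] at hpos
    obtain ⟨c', hc', heq⟩ := hpos
    refine Finset.mem_union_right _ (Finset.mem_biUnion.2 ⟨c', Multiset.mem_toFinset.2 hc', ?_⟩)
    exact Finset.mem_filter.2 ⟨Finset.mem_univ _, heq.symm⟩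
  have h1 := (Finset.card_le_card hsub).trans (Finset.card_union_le _ _)
  have h2 := Finset.card_biUnion_le_card_mul D.toFinset
    (fun c' => Finset.univ.filter fun j => c j = c' j) (K - 1) fun c' hc' =>
      card_agreement_le hc (hD c' (Multiset.mem_toFinset.1 hc'))
        fun he => hcD (he ▸ Multiset.mem_toFinset.1 hc')
  omega

/-- Some interpolating polynomial has weighted degree below the score of the missing codewords. -/
lemma IsNoisyHistogram.exists_interpolates_lt (h : IsNoisyHistogram B D R)
    (hP : IsPreprocessing R P) (hd : 0 < d) (hD : ∀ c ∈ D, c ∈ reedSolomon x K)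
    (hlt : D.toFinset.card * (K - 1) + B.card + s < N) :
    ∃ Q, Interpolates x (d • positivePattern P) Q ∧
      weightedDegree (K - 1) Q < d * (N - s) := by
  classical
  choose! f hf hcf using hD
  obtain ⟨Q, hQ, hdeg⟩ := exists_interpolates (x := x) (v := K - 1) (d := d)
    (M := d • positivePattern P) (G := D.toFinset.image f) (B := B) (fun a j => by
      simp only [Matrix.smul_apply, positivePattern, smul_eq_mul]
      split_ifs <;> simp) (fun g hg => by
      obtain ⟨c, hc, rfl⟩ := Finset.mem_image.1 hg
      have h1 := hf c (Multiset.mem_toFinset.1 hc)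
      by_cases h0 : f c = 0
      · simp [h0]
      · have := (Polynomial.natDegree_lt_iff_degree_lt h0).2 h1
        omega) (fun j hj a ha => by
      have hpos : 0 < P a j := by
        by_contra hn
        simp [positivePattern, hn] at ha
      rw [h.preprocessing_eq hP hj, histogram_pos_iff] at hpos
      obtain ⟨c, hc, rfl⟩ := hpos
      refine ⟨f c, Finset.mem_image_of_mem _ (Multiset.mem_toFinset.2 hc), ?_⟩
      conv_rhs => rw [hcf c hc]
      rfl)
  refine ⟨Q, hQ, hdeg.trans_lt (Nat.mul_lt_mul_of_pos_left ?_ hd)⟩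
  have := Nat.mul_le_mul_right (K - 1) (Finset.card_image_le (s := D.toFinset) (f := f))
  omega

/-- Whatever interpolant is chosen, the list words that are not rejected are exactly the missing
codewords. -/
lemma IsNoisyHistogram.mem_listDecoding_iff (h : IsNoisyHistogram B D R)
    (hP : IsPreprocessing R P) (hd : 0 < d) (hD : ∀ c ∈ D, c ∈ reedSolomon x K) (hBs : B.card ≤ s)
    (hlt : D.toFinset.card * (K - 1) + B.card + s < N) {L : Set (Fin N → F)}
    (hL : IsListDecoding x K (d • positivePattern P) L) (c : Fin N → F) :
    (c ∈ L ∧ d * (N - s) ≤ innerProduct (kautzSingleton c) (d • positivePattern P)) ↔ c ∈ D := by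
  obtain ⟨Q, ⟨hQ, hmin⟩, rfl⟩ := hL
  constructor
  · rintro ⟨⟨f, hf, -, rfl⟩, hle⟩
    exact h.mem_of_le_innerProduct hP hd hD hlt ⟨f, hf, rfl⟩ hle
  · intro hc
    have hle := h.le_innerProduct hP hBs d hc
    refine ⟨?_, hle⟩
    obtain ⟨f, hf, rfl⟩ := hD c hc
    obtain ⟨Q', hQ', hdeg⟩ := h.exists_interpolates_lt hP hd hD hlt
    refine ⟨f, hf, ?_, rfl⟩
    refine dvd_of_weightedDegree_lt_innerProduct (v := K - 1) hQ ?_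
      (((hmin Q' hQ').trans_lt hdeg).trans_le hle)
    by_cases h0 : f = 0
    · simp [h0]
    · have := (Polynomial.natDegree_lt_iff_degree_lt h0).2 hf
      omega

/-- A step is possible exactly when a codeword is missing, and it records each distinct missing
codeword once. -/
lemma IsNoisyHistogram.step_iff (hd : 0 < d) {σ σ' : Config F N}
    (h : IsNoisyHistogram B D σ.residual) (hD : ∀ c ∈ D, c ∈ reedSolomon x K) (hBs : B.card ≤ s)
    (hlt : D.toFinset.card * (K - 1) + B.card + s < N) :
    Step x K d s σ σ' ↔ D ≠ 0 ∧ σ'.residual = σ.residual - histogram D.toFinset.val ∧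
      σ'.found = σ.found + D.toFinset.val := by
  constructor
  · rintro ⟨P, L, S, hP, hP0, hL, hS, hres, hfound⟩
    obtain rfl : S = D.toFinset := by
      ext c
      rw [hS, h.mem_listDecoding_iff hP hd hD hBs hlt hL, Multiset.mem_toFinset]
    exact ⟨fun h0 => hP0 ((h.preprocessing_eq_zero_iff hP).2 h0), hres, hfound⟩
  · rintro ⟨hD0, hres, hfound⟩
    obtain ⟨P, hP⟩ := h.exists_preprocessing
    obtain ⟨Q', hQ', -⟩ := h.exists_interpolates_lt hP hd hD hlt
    obtain ⟨Q, hQ⟩ := exists_isInterpolant (K := K) ⟨Q', hQ'⟩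
    refine ⟨P, factorWords x K Q, D.toFinset, hP,
      fun h0 => hD0 ((h.preprocessing_eq_zero_iff hP).1 h0), ⟨Q, hQ, rfl⟩, fun c => ?_, hres,
      hfound⟩
    rw [h.mem_listDecoding_iff hP hd hD hBs hlt ⟨Q, hQ, rfl⟩, Multiset.mem_toFinset]

end Iteration

/-! ### The whole run -/

section Run

variable {F : Type*} [Field F] [Fintype F] [DecidableEq F] {N K d s : ℕ} {x : Fin N ↪ F}
  {B : Finset (Fin N)}

/-- By induction on the number of missing codewords: from a configuration in which exactly the
multiset `D` is missing, the run is finite and ends with `D` added to the words found. -/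
lemma IsNoisyHistogram.acc_and_found_eq (hd : 0 < d) (hBs : B.card ≤ s) (n : ℕ) :
    ∀ (D : Multiset (Fin N → F)) (σ : Config F N), D.card = n →
      IsNoisyHistogram B D σ.residual → (∀ c ∈ D, c ∈ reedSolomon x K) →
      D.toFinset.card * (K - 1) + B.card + s < N →
      Acc (fun σ' σ => Step x K d s σ σ') σ ∧
        ∀ τ, Relation.ReflTransGen (Step x K d s) σ τ → (¬ ∃ σ', Step x K d s τ σ') →
          Halted τ ∧ τ.found = σ.found + D := by
  induction n using Nat.strong_induction_on with
  | _ n ih =>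
    intro D σ hn h hD hlt
    have hstep : ∀ σ', Step x K d s σ σ' ↔ D ≠ 0 ∧
        σ'.residual = σ.residual - histogram D.toFinset.val ∧
        σ'.found = σ.found + D.toFinset.val := fun σ' => h.step_iff hd hD hBs hlt
    have hval : D.toFinset.val ≤ D := Multiset.dedup_le D
    have hsplit : D - D.toFinset.val + D.toFinset.val = D := tsub_add_cancel_of_le hval
    have hsub : D - D.toFinset.val ≤ D := tsub_le_self
    have next : ∀ σ', Step x K d s σ σ' →
        Acc (fun σ' σ => Step x K d s σ σ') σ' ∧
        ∀ τ, Relation.ReflTransGen (Step x K d s) σ' τ → (¬ ∃ σ'', Step x K d s τ σ'') →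
          Halted τ ∧ τ.found = σ.found + D := by
      intro σ' hσ'
      obtain ⟨hD0, hres, hfound⟩ := (hstep σ').1 hσ'
      have hpos : 0 < D.toFinset.card :=
        Finset.card_pos.2 (Multiset.toFinset_nonempty.2 hD0)
      have hcard : (D - D.toFinset.val).card < n := by
        have := congrArg Multiset.card hsplit
        rw [Multiset.card_add, Finset.card_val] at this
        omega
      have hnoisy : IsNoisyHistogram B (D - D.toFinset.val) σ'.residual := by
        refine ⟨h.two_mul_card_lt, fun j hj a => ?_⟩
        have hadd := congrFun (congrFun (histogram_add (D - D.toFinset.val) D.toFinset.val) a) j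
        rw [hsplit, Matrix.add_apply] at hadd
        rw [hres, Matrix.sub_apply, h.eq_histogram j hj, hadd, add_sub_cancel_right]
      have hle : (D - D.toFinset.val).toFinset.card ≤ D.toFinset.card :=
        Finset.card_le_card (Multiset.toFinset_subset.2 (Multiset.subset_of_le hsub))
      obtain ⟨h1, h2⟩ := ih _ hcard (D - D.toFinset.val) σ' rfl hnoisy
        (fun c hc => hD c (Multiset.mem_of_le hsub hc))
        (by have := Nat.mul_le_mul_right (K - 1) hle; omega)
      refine ⟨h1, fun τ hτ hstuck => ?_⟩
      obtain ⟨h3, h4⟩ := h2 τ hτ hstuck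
      refine ⟨h3, ?_⟩
      rw [h4, hfound, add_assoc, add_comm D.toFinset.val, hsplit]
    refine ⟨Acc.intro σ fun σ' hσ' => (next σ' hσ').1, fun τ hτ hstuck => ?_⟩
    rcases Relation.ReflTransGen.cases_head hτ with rfl | ⟨σ', hσ', hτ'⟩
    · have hD0 : D = 0 := by
        by_contra hne
        exact hstuck ⟨⟨_, _⟩, (hstep _).2 ⟨hne, rfl, rfl⟩⟩
      obtain ⟨P, hP⟩ := h.exists_preprocessing
      obtain rfl := (h.preprocessing_eq_zero_iff hP).2 hD0
      exact ⟨hP, by rw [hD0, add_zero]⟩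
    · exact (next σ' hσ').2 τ hτ' hstuck

end Run

end HistogramRecovery

theorem mainTheorem1 {F : Type*} [Field F] [Fintype F] [DecidableEq F]
    (N K : ℕ) (hK : 2 ≤ K) (hKN : K ≤ N) (x : Fin N ↪ F)
    (t u : ℕ) (C : Multiset (Fin N → F))
    (hC : ∀ c ∈ C, c ∈ HistogramRecovery.reedSolomon x K)
    (ht : C.card = t) (hu : C.toFinset.card = u)
    (H H' : Matrix F (Fin N) ℤ) (hH : H = HistogramRecovery.histogram C)
    (r s : ℕ) (hrs : (r + 1) * s < N)
    (he₁ : HistogramRecovery.e₁ H H' ≤ s) (he₂ : HistogramRecovery.e₂ H H' ≤ r)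
    (d : ℕ) (hd : 0 < d)
    (hbound : (u : ℤ) ≤
      min ⌊(d : ℚ) * ((N : ℚ) - s) ^ 2 / ((N : ℚ) * ((d : ℚ) + 1) * ((K : ℚ) - 1))⌋
        ⌊((N : ℚ) - s - (r : ℚ) * s - 1) / ((K : ℚ) - 1)⌋) :
    HistogramRecovery.Returns x K d s H' C := by
  classical
  subst hH ht
  set B : Finset (Fin N) := Finset.univ.filter fun j : Fin N =>
    (fun a => HistogramRecovery.histogram C a j) ≠ (fun a => H' a j) with hB
  have hBs : B.card ≤ s := he₁
  -- every wrong column has positive distance, so there is none when `r = 0`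
  have hBrs : B.card ≤ r * s := by
    rcases Nat.eq_zero_or_pos r with hr | hr
    · have hempty : B = ∅ := by
        refine Finset.filter_eq_empty_iff.2 fun j _ hne => hne ?_
        have h1 : HistogramRecovery.colDist (HistogramRecovery.histogram C) H' j ≤ r :=
          (Finset.le_sup (Finset.mem_univ j)).trans he₂
        rw [hr, Nat.le_zero, HistogramRecovery.colDist, Finset.sum_eq_zero_iff] at h1
        funext a
        exact sub_eq_zero.1 (Int.natAbs_eq_zero.1 (h1 a (Finset.mem_univ a)))
      simp [hempty]
    · exact hBs.trans (Nat.le_mul_of_pos_left s hr)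
  have hlt : C.toFinset.card * (K - 1) + B.card + s < N := by
    have h1 := Int.le_floor.1 (hbound.trans (min_le_right _ _))
    have hK' : (0 : ℚ) < (K : ℚ) - 1 := by
      have : (2 : ℚ) ≤ K := by exact_mod_cast hK
      linarith
    rw [le_div_iff₀ hK'] at h1
    have h2 : u * (K - 1) + r * s + s + 1 ≤ N := by
      have h3 : ((u * (K - 1) + r * s + s + 1 : ℕ) : ℚ) ≤ N := by
        push_cast [Nat.cast_sub (by omega : 1 ≤ K)]
        push_cast at h1
        linarith
      exact_mod_cast h3
    rw [hu]
    omega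
  have hnoisy : HistogramRecovery.IsNoisyHistogram B C H' := by
    refine ⟨by omega, fun j hj a => ?_⟩
    by_contra hne
    exact hj (Finset.mem_filter.2 ⟨Finset.mem_univ _, fun he => hne (congrFun he a).symm⟩)
  obtain ⟨hacc, hfound⟩ := HistogramRecovery.IsNoisyHistogram.acc_and_found_eq (x := x) (K := K)
    hd hBs C.card C ⟨H', 0⟩ rfl hnoisy hC hlt
  exact ⟨hacc, fun σ hσ hstuck => by simpa using hfound σ hσ hstuck⟩
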